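/- For a countable discrete group $G$ let $\lambda\colon \mathbb{C}G\to\mathbb{B}(\ell^2(G))$ be the left regular representation, $LG=\lambda(\mathbb{C}G)''$ the group von Neumann algebra, and $\tau(x)=\langle x\delta_e,\delta_e\rangle$ its canonical trace. We use the following notions. 1. $\sigma(G)=\inf\{\tau(p)\mid p \text{ a nonzero projection in the centre of } LG\}$ is the central granularity of $G$. 2. $\theta(G)=1/\operatorname{lcm}\{|H| \mid H\leqslant G \text{ finite}\}$ is the torsion multiplier of $G$, with the convention that the least common multiple of an infinite set is $\infty$ and $1/\infty=0$. 3. $G$ satisfies the strong Atiyah conjecture if for every $n$ and every matrix $A\in\mathbb{M}_n(\mathbb{C}G)$, acting on $\ell^2(G)^n$ by left multiplication as the bounded operator $L_A$, the von Neumann dimension $(\tau\otimes\operatorname{Tr})(P_{\ker L_A})$ of its kernel lies in the additive subgroup of $\mathbb{Q}$ generated by $\{1/|H| \mid H\leqslant G\text{ finite}\}$. Here $P_{\ker L_A}$ is the orthogonal projection onto $\ker L_A$ and $\operatorname{Tr}$ is the un-normalized trace. 4. $\mathbb{C}G$ is $C^*_r$-unique if no $C^*$-norm on $\mathbb{C}G$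 is properly majorised by the reduced norm $a\mapsto\|\lambda(a)\|$, that is, if there is no $C^*$-norm $N$ on $\mathbb{C}G$ with $N(a)\le\|\lambda(a)\|$ for all $a$ and $N\neq\|\lambda(\cdot)\|$. **Theorem.** Let $\Gamma$ be a countable discrete group and let $\Lambda\trianglelefteqslant\Gamma$ be a normal subgroup of finite index which satisfies the strong Atiyah conjecture. If $$[\Gamma:\Lambda]^2\cdot\sigma(\Lambda)<\theta(\Lambda),$$ then $\mathbb{C}\Gamma$ is not $C^*_r$-unique. -/

import Mathlib

noncomputable section

namespace GroupAlgebraNorms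

/-- The Hilbert space `ℓ²(G)` of square-summable complex functions on `G`. -/
abbrev L2 (G : Type*) : Type _ := lp (fun _ : G => ℂ) 2

/-- The canonical unit vector `δ_e` of `ℓ²(G)`. -/
def deltaOne (G : Type*) [Group G] : L2 G :=
  haveI := Classical.decEq G
  lp.single 2 (1 : G) (1 : ℂ)

/-- Left translation by `g` on `ℓ²(G)`: `(g f)(h) = f (g⁻¹ h)`. -/
def translate {G : Type*} [Group G] (g : G) : L2 G →ₗᵢ[ℂ] L2 G where
  toFun f := ⟨fun h => f (g⁻¹ * h), by
    refine memℓp_gen ?_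
    have hf := (lp.memℓp f).summable (by norm_num)
    exact hf.comp_injective (mul_right_injective g⁻¹)⟩
  map_add' _ _ := rfl
  map_smul' _ _ := rfl
  norm_map' f := by
    have h2 : (0 : ℝ) < (2 : ENNReal).toReal := by norm_num
    rw [lp.norm_eq_tsum_rpow h2, lp.norm_eq_tsum_rpow h2]
    congr 1
    exact (Equiv.mulLeft g⁻¹).tsum_eq (fun h => ‖f h‖ ^ (2 : ENNReal).toReal)

/-- The left regular representation of the group `G` on `ℓ²(G)`. -/
def leftRegular (G : Type*) [Group G] : G →* (L2 G →L[ℂ] L2 G) where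
  toFun g := (translate g).toContinuousLinearMap
  map_one' := by
    ext f h
    change f (1⁻¹ * h) = f h
    simp
  map_mul' g k := by
    ext f h
    change f ((g * k)⁻¹ * h) = f (k⁻¹ * (g⁻¹ * h))
    rw [mul_inv_rev, mul_assoc]

/-- The left regular representation `λ : ℂ[G] → B(ℓ²(G))` of the complex group algebra. -/
def regRep (G : Type*) [Group G] : MonoidAlgebra ℂ G →ₐ[ℂ] (L2 G →L[ℂ] L2 G) :=
  MonoidAlgebra.lift ℂ (L2 G →L[ℂ] L2 G) G (leftRegular G)

/-- The reduced norm on the complex group algebra. -/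
def reducedNorm {G : Type*} [Group G] (a : MonoidAlgebra ℂ G) : ℝ := ‖regRep G a‖

/-- The involution of the complex group algebra: `(∑ c_g g)^* = ∑ conj(c_g) g⁻¹`. -/
def involution {G : Type*} [Group G] (a : MonoidAlgebra ℂ G) : MonoidAlgebra ℂ G :=
  a.coeff.sum fun g c => MonoidAlgebra.single g⁻¹ (star c)

/-- A norm of complex algebras on `ℂ[G]` (submultiplicative and definite) is a `C*`-norm if it
satisfies the `C*`-identity. -/
def IsCStarNorm {G : Type*} [Group G] (N : AlgebraNorm ℂ (MonoidAlgebra ℂ G)) : Prop :=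
  ∀ a : MonoidAlgebra ℂ G, N (involution a * a) = N a ^ 2

/-- `ℂ[G]` is `C*_r`-unique: no `C*`-norm on it is properly majorised by the reduced norm. -/
def IsReducedCStarUnique (G : Type*) [Group G] : Prop :=
  ¬ ∃ N : AlgebraNorm ℂ (MonoidAlgebra ℂ G), IsCStarNorm N ∧
    (∀ a, N a ≤ reducedNorm a) ∧ ∃ a, N a ≠ reducedNorm a

/-- The group von Neumann algebra `L(G) = λ(ℂ[G])''` on `ℓ²(G)`. -/
def groupVN (G : Type*) [Group G] : VonNeumannAlgebra (L2 G) where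
  toStarSubalgebra := StarSubalgebra.centralizer ℂ
    (StarSubalgebra.centralizer ℂ (Set.range (regRep G)) : Set (L2 G →L[ℂ] L2 G))
  centralizer_centralizer' := by
    change Set.centralizer (Set.centralizer
      ((StarSubalgebra.centralizer ℂ (StarSubalgebra.centralizer ℂ (Set.range (regRep G)) :
        Set (L2 G →L[ℂ] L2 G)) : StarSubalgebra ℂ (L2 G →L[ℂ] L2 G)) : Set (L2 G →L[ℂ] L2 G)))
      = ((StarSubalgebra.centralizer ℂ (StarSubalgebra.centralizer ℂ (Set.range (regRep G)) :
        Set (L2 G →L[ℂ] L2 G)) : StarSubalgebra ℂ (L2 G →L[ℂ] L2 G)) : Set (L2 G →L[ℂ] L2 G))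
    rw [StarSubalgebra.coe_centralizer_centralizer, Set.centralizer_centralizer_centralizer]

/-- The canonical trace `τ(x) = ⟨x δ_e, δ_e⟩` (in Mathlib the inner product is conjugate-linear
in its first argument). -/
def vnTrace {G : Type*} [Group G] (x : L2 G →L[ℂ] L2 G) : ℂ :=
  inner ℂ (deltaOne G) (x (deltaOne G))

/-- `p` is a projection in the centre of `L(G)`. -/
def IsCentralProjection {G : Type*} [Group G] (p : L2 G →L[ℂ] L2 G) : Prop :=
  IsStarProjection p ∧ p ∈ groupVN G ∧ ∀ x ∈ groupVN G, x * p = p * x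

/-- The central granularity `σ(G)`: the infimum of the traces of the nonzero projections in the
centre of `L(G)` (these traces are real). -/
def centralGranularity (G : Type*) [Group G] : ℝ :=
  sInf {t : ℝ | ∃ p : L2 G →L[ℂ] L2 G, IsCentralProjection p ∧ p ≠ 0 ∧ t = (vnTrace p).re}

/-- The set of orders of the finite subgroups of `G`. -/
def finiteSubgroupOrders (G : Type*) [Group G] : Set ℕ :=
  {n | ∃ H : Subgroup G, Finite H ∧ n = Nat.card H}

open Classical in
/-- The torsion multiplier `θ(G)`, the inverse of the least common multiple of the orders of the
finite subgroups of `G`; the lcm of an infinite set is infinity and `1 / ∞ = 0`. -/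
def torsionMultiplier (G : Type*) [Group G] : ℝ :=
  if h : (finiteSubgroupOrders G).Finite then 1 / ((h.toFinset.lcm id : ℕ) : ℝ) else 0

/-- The additive subgroup of `ℚ` generated by the inverses of the orders of the finite
subgroups of `G`. -/
def invOrderSubgroup (G : Type*) [Group G] : AddSubgroup ℚ :=
  AddSubgroup.closure {q : ℚ | ∃ n ∈ finiteSubgroupOrders G, q = 1 / (n : ℚ)}

/-- The Hilbert space `ℓ²(G)^n`. -/
abbrev L2Pow (G : Type*) (n : ℕ) : Type _ := PiLp 2 (fun _ : Fin n => L2 G)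

/-- The bounded operator `L_A` on `ℓ²(G)^n` given by left multiplication by the matrix `A`:
`(L_A v)_i = ∑_j λ(A_{ij}) v_j`. -/
def matrixOp {G : Type*} [Group G] {n : ℕ} (A : Matrix (Fin n) (Fin n) (MonoidAlgebra ℂ G)) :
    L2Pow G n →L[ℂ] L2Pow G n :=
  (PiLp.continuousLinearEquiv 2 ℂ (fun _ : Fin n => L2 G)).symm.toContinuousLinearMap ∘L
    ContinuousLinearMap.pi fun i =>
      ∑ j, regRep G (A i j) ∘L PiLp.proj 2 (fun _ : Fin n => L2 G) j

/-- The un-normalised trace `(τ ⊗ Tr)(T) = ∑_i τ(T_{ii})` of an operator on `ℓ²(G)^n`, where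
`T_{ij}` are the matrix entries of `T`. -/
def matrixTrace {G : Type*} [Group G] {n : ℕ} (T : L2Pow G n →L[ℂ] L2Pow G n) : ℂ :=
  ∑ i : Fin n, inner ℂ (deltaOne G) (T (PiLp.single 2 i (deltaOne G)) i)

/-- The von Neumann dimension of the kernel of `L_A`, that is, the trace of the orthogonal
projection onto this kernel. -/
def kerDim {G : Type*} [Group G] {n : ℕ} (A : Matrix (Fin n) (Fin n) (MonoidAlgebra ℂ G)) : ℂ :=
  matrixTrace (LinearMap.ker (matrixOp A).toLinearMap).starProjection

/-- The strong Atiyah conjecture for `G`: the von Neumann dimension of the kernel of every square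
matrix over `ℂ[G]` lies in the additive subgroup of `ℚ` generated by the inverses of the
orders of the finite subgroups of `G`. -/
def StrongAtiyah (G : Type*) [Group G] : Prop :=
  ∀ (n : ℕ) (A : Matrix (Fin n) (Fin n) (MonoidAlgebra ℂ G)),
    ∃ q ∈ invOrderSubgroup G, kerDim A = (q : ℂ)

end GroupAlgebraNorms

end

/-! The aim is a nonzero `f` in the reduced C*-algebra of Γ, commuting with λ(ℂΓ), whose kernel
projection q still separates ℂΓ. Then a ↦ ‖λ(a)q‖ is a C*-norm below the reduced norm. If the two
agreed on ℂΓ, they would agree on its closure, contradicting f q = 0 and f ≠ 0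
(`not_isReducedCStarUnique_of_mul_eq_zero`).

The hypothesis gives σ(Λ) < θ(Λ), hence some nonzero central projection p of LΛ has trace below
θ(Λ). If Λ had only finitely many elements with finite conjugacy class, p would lie in ℂΛ, and
strong Atiyah for 1 - p would make τ(p) an integer multiple of θ(Λ), hence zero
(`infinite_of_centralGranularity_lt`). So Λ contains infinitely many finite conjugacy classes of Γ.
Their class sums span an infinite-dimensional subspace of a commutative C*-algebra,
`centralAlgebra`, which therefore contains infinitely many orthogonal self-adjoint elements. By
Bessel's inequality one of them, f, has δ_e within squared distance θ(Λ) of its kernel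
(`exists_ker_close`).

If λ(a)q = 0, cutting qδ_e down to ℓ²(Λ) gives a vector near δ_e that every coset part of a
annihilates. Strong Atiyah leaves no dimension strictly between 1 - θ(Λ) and 1, so these parts
vanish and a = 0 (`StrongAtiyah.eq_zero_of_close`). The cut-down stays in ker f because
`centralAlgebra` also requires commutation with `cutoff Λ`. -/

noncomputable section

namespace GroupAlgebraNorms

/-! ### Orthogonal self-adjoint operators and kernel projections -/

section Hilbert

variable {H : Type*} [NormedAddCommGroup H] [InnerProductSpace ℂ H] [CompleteSpace H]

/-- An infinite-dimensional commutative `C*`-algebra contains infinitely many pairwise orthogonal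
nonzero self-adjoint elements. -/
theorem exists_orthogonal_selfAdjoint (A : Type*) [CommCStarAlgebra A]
    (hA : ¬ FiniteDimensional ℂ A) :
    ∃ f : ℕ → A, (∀ n, f n ≠ 0) ∧ (∀ n, star (f n) = f n) ∧
      ∀ i j, i ≠ j → f i * f j = 0 := by
  let X := WeakDual.characterSpace ℂ A
  have e := gelfandStarTransform A
  have hX : Infinite X := by
    by_contra h
    rw [not_infinite_iff_finite] at h
    have h1 : FiniteDimensional ℂ C(X, ℂ) :=
      Module.Finite.of_injective (ContinuousMap.coeFnLinearMap ℂ : C(X, ℂ) →ₗ[ℂ] X → ℂ)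
        DFunLike.coe_injective
    exact hA (Module.Finite.of_injective
      (e.toAlgEquiv.toLinearEquiv : A →ₗ[ℂ] C(X, ℂ)) e.injective)
  -- Urysohn functions supported in disjoint open sets of the infinite spectrum give the orthogonal
  -- elements.
  obtain ⟨U, hUi, hUo, hUd⟩ := exists_seq_infinite_isOpen_pairwise_disjoint X
  choose x hx using fun n => (hUi n).nonempty
  have hur : ∀ n, ∃ φ : C(X, ℝ), Set.EqOn φ 0 (U n)ᶜ ∧ φ (x n) = 1 := fun n => by
    obtain ⟨φ, h0, h1, -⟩ := exists_continuous_zero_one_of_isClosed (hUo n).isClosed_compl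
      (isClosed_singleton (x := x n)) (by simpa using hx n)
    exact ⟨φ, h0, h1 rfl⟩
  choose φ hφ0 hφ1 using hur
  let ψ : ℕ → C(X, ℂ) := fun n => ⟨fun y => (φ n y : ℂ), by fun_prop⟩
  refine ⟨fun n => e.symm (ψ n), fun n h => ?_, fun n => ?_, fun i j hij => ?_⟩
  · have h2 : ψ n = 0 := by simpa using h
    have h3 : ψ n (x n) = 0 := by rw [h2]; rfl
    simp [ψ, hφ1] at h3
  · rw [← map_star]
    congr 1
    ext y
    simp [ψ]
  · rw [← map_mul]
    have : ψ i * ψ j = 0 := by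
      ext y
      by_cases hy : y ∈ U i
      · have : y ∈ (U j)ᶜ := Set.disjoint_left.mp (hUd hij) hy
        simp [ψ, hφ0 j this]
      · simp [ψ, hφ0 i hy]
    rw [this, map_zero]

/-- Among infinitely many pairwise orthogonal self-adjoint operators, some kernel comes as close
to a given vector as desired. -/
theorem exists_ker_close (f : ℕ → H →L[ℂ] H) (hs : ∀ n, star (f n) = f n)
    (ho : ∀ i j, i ≠ j → f i * f j = 0) (v : H) {ε : ℝ} (hε : 0 < ε) :
    ∃ n, ‖v - (LinearMap.ker (f n).toLinearMap).starProjection v‖ ^ 2 < ε := by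
  by_contra! hcon
  set w : ℕ → H := fun n => v - (LinearMap.ker (f n).toLinearMap).starProjection v with hw
  have hwo : ∀ n, w n ∈ (LinearMap.ker (f n).toLinearMap)ᗮ := fun n =>
    Submodule.sub_starProjection_mem_orthogonal v
  -- By self-adjointness (ker f_i)ᗮ is the closed range of f_i, which f_j annihilates.
  have hwk : ∀ i j, i ≠ j → w i ∈ LinearMap.ker (f j).toLinearMap := fun i j hij => by
    have h1 := hwo i
    rw [ContinuousLinearMap.orthogonal_ker, ← ContinuousLinearMap.star_eq_adjoint, hs] at h1
    refine Submodule.topologicalClosure_minimal _ ?_ (f j).isClosed_ker h1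
    rintro _ ⟨y, rfl⟩
    have := congrArg (fun T : H →L[ℂ] H => T y) (ho j i hij.symm)
    simpa using this
  have hoo : ∀ i j, i ≠ j → inner ℂ (w i) (w j) = 0 := fun i j hij =>
    (Submodule.mem_orthogonal _ _).mp (hwo j) _ (hwk i j hij)
  have hwv : ∀ n, inner ℂ (w n) v = inner ℂ (w n) (w n) := fun n => by
    have : inner ℂ (w n) ((LinearMap.ker (f n).toLinearMap).starProjection v) = 0 :=
      (Submodule.mem_orthogonal' _ _).mp (hwo n) _ (Submodule.starProjection_apply_mem _ _)
    conv_rhs => rw [hw]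
    simp only [inner_sub_right]
    rw [this, sub_zero]
  -- Bessel's inequality for the first m of the w n: their squared norms sum to at most ‖v‖², but
  -- each is at least ε.
  obtain ⟨m, hm⟩ := exists_nat_gt (‖v‖ ^ 2 / ε)
  set s := ∑ n ∈ Finset.range m, w n with hsdef
  have hss : inner ℂ s s = inner ℂ s v := by
    rw [hsdef, sum_inner, sum_inner]
    refine Finset.sum_congr rfl fun i hi => ?_
    rw [inner_sum, Finset.sum_eq_single i (fun j _ hj => hoo i j hj.symm)
      (fun h => absurd hi h), hwv]
  have hle : ‖s‖ ^ 2 ≤ ‖v‖ ^ 2 := by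
    have h1 : ‖s‖ ^ 2 = ‖inner ℂ s v‖ := by
      rw [← hss, inner_self_eq_norm_sq_to_K]; simp
    have h2 := norm_inner_le_norm (𝕜 := ℂ) s v
    have : ‖s‖ ≤ ‖v‖ := by
      by_contra! h3
      nlinarith [norm_nonneg s, norm_nonneg v]
    gcongr
  have hge : ‖s‖ ^ 2 = ∑ n ∈ Finset.range m, ‖w n‖ ^ 2 := by
    have h1 : inner ℂ s s = ∑ n ∈ Finset.range m, inner ℂ (w n) (w n) := by
      rw [hss, hsdef, sum_inner]
      exact Finset.sum_congr rfl fun i _ => hwv i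
    simp only [inner_self_eq_norm_sq_to_K] at h1
    exact_mod_cast h1
  have : (m : ℝ) * ε ≤ ‖s‖ ^ 2 := by
    rw [hge]
    calc (m : ℝ) * ε = ∑ n ∈ Finset.range m, ε := by simp
      _ ≤ _ := Finset.sum_le_sum fun n _ => hcon n
  rw [div_lt_iff₀ hε] at hm
  linarith

/-- The projection onto the kernel of `f` commutes with every operator that commutes, together
with its adjoint, with `f`. -/
theorem commute_starProjection_ker {f T : H →L[ℂ] H} (h : Commute T f) (h' : Commute (star T) f) :
    Commute T (LinearMap.ker f.toLinearMap).starProjection := by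
  ext v
  set K := LinearMap.ker f.toLinearMap
  refine (Submodule.eq_starProjection_of_mem_of_inner_eq_zero ?_ fun w hw => ?_).symm
  · have h1 : f (K.starProjection v) = 0 := Submodule.starProjection_apply_mem K v
    have := congrArg (fun S : H →L[ℂ] H => S (K.starProjection v)) h.eq
    simp only [mul_apply_eq_comp, h1, map_zero] at this
    exact this.symm
  · have h1 : star T w ∈ K := by
      have h0 : f w = 0 := hw
      have := congrArg (fun S : H →L[ℂ] H => S w) h'.eq
      simp only [mul_apply_eq_comp, h0, map_zero] at this
      exact this.symm
    have h2 := Submodule.starProjection_inner_eq_zero v (star T w) h1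
    rw [ContinuousLinearMap.star_eq_adjoint, ContinuousLinearMap.adjoint_inner_right] at h2
    simpa using h2

/-- With v = δ_e this turns traces of projections into squared norms, the form in which dimensions
are compared. -/
theorem inner_apply_of_isStarProjection {p : H →L[ℂ] H} (hp : IsStarProjection p) (v : H) :
    inner ℂ v (p v) = ((‖p v‖ ^ 2 : ℝ) : ℂ) := by
  have h1 : p v = p (p v) := by
    rw [← mul_apply_eq_comp, hp.isIdempotentElem.eq]
  rw [h1, ← ContinuousLinearMap.adjoint_inner_left, ← ContinuousLinearMap.star_eq_adjoint,
    hp.isSelfAdjoint.star_eq, ← h1, inner_self_eq_norm_sq_to_K]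
  simp

/-- Presents the range of a projection as a kernel, since the Atiyah conjecture speaks of kernels.
-/
theorem starProjection_ker_one_sub {p : H →L[ℂ] H} (hp : IsStarProjection p) (v : H) :
    (LinearMap.ker (1 - p).toLinearMap).starProjection v = p v := by
  have h1 : ∀ v, p (p v) = p v := fun v => by
    rw [← mul_apply_eq_comp, hp.isIdempotentElem.eq]
  refine (Submodule.eq_starProjection_of_mem_of_inner_eq_zero ?_ fun w hw => ?_)
  · change p v - p (p v) = 0
    rw [h1, sub_self]
  · have hw' : w - p w = 0 := hw
    rw [sub_eq_zero.mp hw', ← ContinuousLinearMap.adjoint_inner_left,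
      ← ContinuousLinearMap.star_eq_adjoint, hp.isSelfAdjoint.star_eq, map_sub, h1, sub_self,
      inner_zero_left]

end Hilbert

/-! ### The standard basis of ℓ²(G) -/

section Delta

variable {G : Type*}

/-- The unit vector `δ_g` of `ℓ²(G)`. -/
def delta (g : G) : L2 G :=
  haveI := Classical.decEq G
  lp.single 2 g (1 : ℂ)

theorem delta_apply_self (g : G) : delta g g = 1 := by
  classical
  simp [delta]

theorem delta_apply_ne {g x : G} (h : x ≠ g) : delta g x = 0 := by
  classical
  simp [delta, h]

theorem inner_delta (g : G) (f : L2 G) : inner ℂ (delta g) f = f g := by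
  classical
  rw [delta, lp.inner_single_left]
  simp

theorem norm_delta (g : G) : ‖delta g‖ = 1 := by
  classical
  rw [delta, lp.norm_single (by norm_num)]
  simp

/-- A bounded operator on `ℓ²(G)` vanishing on the standard basis is zero. -/
theorem eq_zero_of_apply_delta {T : L2 G →L[ℂ] L2 G} (h : ∀ g, T (delta g) = 0) : T = 0 := by
  rw [← star_eq_zero]
  ext ξ x
  rw [← inner_delta, ContinuousLinearMap.star_eq_adjoint, ContinuousLinearMap.adjoint_inner_right,
    h]
  simp

end Delta

/-! ### The regular representation on basis vectors and its adjoint -/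

section Basics

variable {G : Type*} [Group G]

theorem delta_one : delta (1 : G) = deltaOne G := rfl

theorem leftRegular_apply (g : G) (f : L2 G) (x : G) : leftRegular G g f x = f (g⁻¹ * x) := rfl

theorem leftRegular_delta (g h : G) : leftRegular G g (delta h) = delta (g * h) := by
  ext x
  rw [leftRegular_apply]
  by_cases hx : x = g * h
  · subst hx; simp [delta_apply_self]
  · rw [delta_apply_ne hx, delta_apply_ne]
    rintro rfl
    exact hx (by group)

theorem regRep_single (g : G) (c : ℂ) :
    regRep G (MonoidAlgebra.single g c) = c • leftRegular G g := by
  simp [regRep]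

theorem regRep_eq_sum (a : MonoidAlgebra ℂ G) :
    regRep G a = ∑ g ∈ a.coeff.support, a.coeff g • leftRegular G g := by
  rw [regRep, MonoidAlgebra.lift_apply]; rfl

theorem regRep_apply (a : MonoidAlgebra ℂ G) (f : L2 G) (x : G) :
    regRep G a f x = a.coeff.sum fun g c => c * f (g⁻¹ * x) := by
  rw [regRep_eq_sum, _root_.sum_apply, lp.coeFn_sum, Finset.sum_apply]
  rfl

theorem regRep_deltaOne (a : MonoidAlgebra ℂ G) (x : G) :
    regRep G a (deltaOne G) x = a.coeff x := by
  classical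
  rw [regRep_apply, Finsupp.sum, Finset.sum_eq_single x]
  · simp [← delta_one, delta_apply_self]
  · intro g _ hg
    rw [← delta_one, delta_apply_ne, mul_zero]
    rw [ne_eq, inv_mul_eq_one]; exact hg
  · intro h
    rw [Finsupp.notMem_support_iff.mp h, zero_mul]

theorem eq_zero_of_regRep_deltaOne {a : MonoidAlgebra ℂ G} (h : regRep G a (deltaOne G) = 0) :
    a = 0 := by
  ext x
  rw [← regRep_deltaOne, h]; rfl

theorem star_leftRegular (g : G) : star (leftRegular G g) = leftRegular G g⁻¹ := by
  rw [ContinuousLinearMap.star_eq_adjoint]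
  symm
  rw [ContinuousLinearMap.eq_adjoint_iff]
  intro x y
  calc inner ℂ (leftRegular G g⁻¹ x) y
      = inner ℂ (leftRegular G g (leftRegular G g⁻¹ x)) (leftRegular G g y) :=
        ((translate g).inner_map_map _ _).symm
    _ = inner ℂ x (leftRegular G g y) := by
        rw [← mul_apply_eq_comp, ← map_mul, mul_inv_cancel, map_one]; rfl

theorem regRep_involution (a : MonoidAlgebra ℂ G) :
    regRep G (involution a) = star (regRep G a) := by
  rw [involution, Finsupp.sum, map_sum, regRep_eq_sum, star_sum]
  refine Finset.sum_congr rfl fun g _ => ?_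
  rw [regRep_single, star_smul, star_leftRegular]

theorem commute_regRep {T : L2 G →L[ℂ] L2 G} (h : ∀ g, Commute T (leftRegular G g))
    (a : MonoidAlgebra ℂ G) : Commute T (regRep G a) := by
  rw [regRep_eq_sum]
  exact Commute.sum_right _ _ _ fun g _ => (h g).smul_right _

end Basics

/-! ### Integrality of kernel dimensions -/

section Atiyah

variable {G : Type*} [Group G]

theorem matrixOp_apply {n : ℕ} (A : Matrix (Fin n) (Fin n) (MonoidAlgebra ℂ G)) (v : L2Pow G n)
    (i : Fin n) : matrixOp A v i = ∑ j, regRep G (A i j) (v j) := by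
  simp [matrixOp]

theorem kerDim_fin_one (b : MonoidAlgebra ℂ G) :
    kerDim (Matrix.of fun _ _ : Fin 1 => b) =
      ((‖(LinearMap.ker (regRep G b).toLinearMap).starProjection (deltaOne G)‖ ^ 2 : ℝ) : ℂ) := by
  set K := LinearMap.ker (regRep G b).toLinearMap
  have h : (LinearMap.ker (matrixOp (Matrix.of fun _ _ : Fin 1 => b)).toLinearMap).starProjection
      (PiLp.single 2 0 (deltaOne G)) = PiLp.single 2 0 (K.starProjection (deltaOne G)) := by
    refine Submodule.eq_starProjection_of_mem_of_inner_eq_zero ?_ fun w hw => ?_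
    · change matrixOp _ _ = 0
      ext1 i
      have h1 : regRep G b (K.starProjection (deltaOne G)) = 0 :=
        Submodule.starProjection_apply_mem K _
      rw [matrixOp_apply]
      fin_cases i
      simp [h1]
    · have h1 : w 0 ∈ K := by
        have : matrixOp (Matrix.of fun _ _ : Fin 1 => b) w = 0 := hw
        have h2 := matrixOp_apply (Matrix.of fun _ _ : Fin 1 => b) w 0
        rw [this] at h2
        have h3 : regRep G b (w 0) = 0 := by simpa using h2.symm
        exact h3
      rw [PiLp.inner_apply]
      simpa [-Submodule.starProjection_inner_eq_zero, inner_sub_left] using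
        Submodule.starProjection_inner_eq_zero (K := K) (deltaOne G) _ h1
  rw [kerDim, matrixTrace, Fin.sum_univ_one, h, PiLp.single_eq_same,
    inner_apply_of_isStarProjection isStarProjection_starProjection]

/-- Makes codimensions of kernels, and not just dimensions, integer multiples of θ(G). -/
theorem exists_nat_mul_torsionMultiplier (h : 0 < torsionMultiplier G) :
    ∃ k : ℕ, (k : ℝ) * torsionMultiplier G = 1 := by
  rw [torsionMultiplier] at h ⊢
  split_ifs at h ⊢ with hf
  · exact ⟨_, mul_one_div_cancel (one_div_pos.mp h).ne'⟩
  · exact absurd h (lt_irrefl _)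

/-- Each |H| divides the lcm, so each generator 1/|H| is a multiple of 1/lcm; positivity excludes
the branch where θ(G) = 0. -/
theorem exists_int_mul_torsionMultiplier (h : 0 < torsionMultiplier G) {q : ℚ}
    (hq : q ∈ invOrderSubgroup G) : ∃ k : ℤ, (q : ℝ) = k * torsionMultiplier G := by
  rw [torsionMultiplier] at h ⊢
  split_ifs at h ⊢ with hf
  · set l := hf.toFinset.lcm id
    have hl : (l : ℝ) ≠ 0 := (one_div_pos.mp h).ne'
    rw [invOrderSubgroup] at hq
    induction hq using AddSubgroup.closure_induction with
    | mem x hx =>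
      obtain ⟨n, hn, rfl⟩ := hx
      obtain ⟨c, hc⟩ : n ∣ l := Finset.dvd_lcm (f := id) (hf.mem_toFinset.mpr hn)
      have hn0 : (n : ℝ) ≠ 0 := by
        rintro h0
        rw [hc] at hl
        simp [h0] at hl
      refine ⟨c, ?_⟩
      rw [hc] at hl ⊢
      push_cast at hl ⊢
      have hc0 : (c : ℝ) ≠ 0 := right_ne_zero_of_mul hl
      field_simp
    | zero => exact ⟨0, by simp⟩
    | add x y _ _ hx hy =>
      obtain ⟨a, ha⟩ := hx
      obtain ⟨b, hb⟩ := hy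
      exact ⟨a + b, by push_cast; rw [ha, hb]; ring⟩
    | neg x _ hx =>
      obtain ⟨a, ha⟩ := hx
      exact ⟨-a, by push_cast; rw [ha]; ring⟩
  · exact absurd h (lt_irrefl _)

theorem StrongAtiyah.exists_int (hA : StrongAtiyah G) (h : 0 < torsionMultiplier G)
    (b : MonoidAlgebra ℂ G) : ∃ k : ℤ,
      ‖(LinearMap.ker (regRep G b).toLinearMap).starProjection (deltaOne G)‖ ^ 2 =
        k * torsionMultiplier G := by
  obtain ⟨q, hq, hk⟩ := hA 1 (Matrix.of fun _ _ => b)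
  obtain ⟨k, hk'⟩ := exists_int_mul_torsionMultiplier h hq
  refine ⟨k, ?_⟩
  rw [kerDim_fin_one] at hk
  rw [← hk']
  exact_mod_cast hk

theorem eq_zero_of_int_mul_lt {t θ : ℝ} {k : ℤ} (ht : t = k * θ) (h0 : 0 ≤ t) (h1 : t < θ) :
    t = 0 := by
  have hθ : 0 < θ := h0.trans_lt h1
  have hk0 : (-1 : ℝ) < k := by
    by_contra! h
    nlinarith
  have hk1 : (k : ℝ) < 1 := by
    by_contra! h
    nlinarith
  have h2 : (-1 : ℤ) < k := by exact_mod_cast hk0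
  have h3 : k < (1 : ℤ) := by exact_mod_cast hk1
  have : k = 0 := by omega
  simp [ht, this]

/-- An element of the group algebra whose kernel is close enough to the vector `δ_e` is zero. -/
theorem StrongAtiyah.eq_zero_of_close (hA : StrongAtiyah G) (b : MonoidAlgebra ℂ G) (v : L2 G)
    (hv : regRep G b v = 0) (h : ‖deltaOne G - v‖ ^ 2 < torsionMultiplier G) : b = 0 := by
  have hθ : 0 < torsionMultiplier G := (by positivity : (0 : ℝ) ≤ _).trans_lt h
  set K := LinearMap.ker (regRep G b).toLinearMap with hK
  obtain ⟨k, hk⟩ := hA.exists_int hθ b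
  obtain ⟨n, hn⟩ := exists_nat_mul_torsionMultiplier hθ
  have hpyth : ‖deltaOne G - K.starProjection (deltaOne G)‖ ^ 2 =
      1 - ‖K.starProjection (deltaOne G)‖ ^ 2 := by
    have h1 := K.norm_sq_eq_add_norm_sq_starProjection (deltaOne G)
    rw [Submodule.starProjection_orthogonal_val, ← delta_one, norm_delta] at h1
    rw [← delta_one]
    linarith
  have hle : ‖deltaOne G - K.starProjection (deltaOne G)‖ ≤ ‖deltaOne G - v‖ := by
    rw [Submodule.starProjection_minimal]
    exact ciInf_le ⟨0, by rintro _ ⟨y, rfl⟩; positivity⟩ (⟨v, hv⟩ : K)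
  -- The codimension of the kernel is 1 - kθ = (n - k)θ and lies below θ, so it vanishes and δ_e is
  -- in the kernel.
  have h0 := eq_zero_of_int_mul_lt (t := ‖deltaOne G - K.starProjection (deltaOne G)‖ ^ 2)
    (k := n - k) (by rw [hpyth, hk]; push_cast; linarith) (by positivity)
    ((by gcongr : _ ≤ ‖deltaOne G - v‖ ^ 2).trans_lt h)
  have h1 : deltaOne G = K.starProjection (deltaOne G) := by
    rw [← sub_eq_zero, ← norm_eq_zero]
    exact pow_eq_zero_iff two_ne_zero |>.mp h0
  apply eq_zero_of_regRep_deltaOne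
  have h2 : K.starProjection (deltaOne G) ∈ K := Submodule.starProjection_apply_mem K _
  rwa [← h1] at h2

end Atiyah

/-! ### Central projections when few conjugacy classes are finite -/

section FiniteCentre

variable {G : Type*} [Group G]

/-- Right translation by `g` on `ℓ²(G)`: `(ρ_g f)(h) = f (h g)`. -/
def rightTranslate (g : G) : L2 G →L[ℂ] L2 G :=
  LinearIsometry.toContinuousLinearMap
  { toFun := fun f => ⟨fun h => f (h * g), by
      refine memℓp_gen ?_
      have hf := (lp.memℓp f).summable (by norm_num)
      exact hf.comp_injective (mul_left_injective g)⟩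
    map_add' := fun _ _ => rfl
    map_smul' := fun _ _ => rfl
    norm_map' := fun f => by
      have h2 : (0 : ℝ) < (2 : ENNReal).toReal := by norm_num
      rw [lp.norm_eq_tsum_rpow h2, lp.norm_eq_tsum_rpow h2]
      congr 1
      exact (Equiv.mulRight g).tsum_eq (fun h => ‖f h‖ ^ (2 : ENNReal).toReal) }

theorem rightTranslate_apply (g : G) (f : L2 G) (x : G) : rightTranslate g f x = f (x * g) := rfl

theorem rightTranslate_deltaOne (g : G) : rightTranslate g⁻¹ (deltaOne G) = delta g := by
  ext x
  rw [rightTranslate_apply, ← delta_one]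
  by_cases hx : x = g
  · subst hx; simp [delta_apply_self]
  · rw [delta_apply_ne hx, delta_apply_ne]
    rwa [ne_eq, mul_inv_eq_one]

theorem commute_rightTranslate_regRep (g : G) (a : MonoidAlgebra ℂ G) :
    Commute (rightTranslate g) (regRep G a) :=
  commute_regRep (fun h => by
    ext f x
    change f (h⁻¹ * (x * g)) = f (h⁻¹ * x * g)
    rw [mul_assoc]) a

theorem mem_groupVN_iff {T : L2 G →L[ℂ] L2 G} :
    T ∈ groupVN G ↔ T ∈ StarSubalgebra.centralizer ℂ
    (StarSubalgebra.centralizer ℂ (Set.range (regRep G)) : Set (L2 G →L[ℂ] L2 G)) := Iff.rfl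

theorem regRep_mem_groupVN (a : MonoidAlgebra ℂ G) : regRep G a ∈ groupVN G := by
  rw [mem_groupVN_iff, StarSubalgebra.mem_centralizer_iff]
  intro T hT
  have hT' : star T ∈ StarSubalgebra.centralizer ℂ (Set.range (regRep G)) := star_mem hT
  exact ⟨((StarSubalgebra.mem_centralizer_iff ℂ).mp hT _ ⟨a, rfl⟩).1.symm,
    ((StarSubalgebra.mem_centralizer_iff ℂ).mp hT' _ ⟨a, rfl⟩).1.symm⟩

/-- Right translations lie in the commutant of λ(ℂG). They carry δ_e to every δ_g, which makes δ_e
separating. -/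
theorem commute_rightTranslate_of_mem_groupVN {T : L2 G →L[ℂ] L2 G} (hT : T ∈ groupVN G) (g : G) :
    Commute (rightTranslate g) T := by
  refine ((StarSubalgebra.mem_centralizer_iff ℂ).mp (mem_groupVN_iff.mp hT) _ ?_).1
  refine (StarSubalgebra.mem_centralizer_iff ℂ).mpr ?_
  rintro _ ⟨a, rfl⟩
  rw [← regRep_involution]
  exact ⟨(commute_rightTranslate_regRep g a).symm, (commute_rightTranslate_regRep g _).symm⟩

/-- The group von Neumann algebra is separated by the vector `δ_e`. -/
theorem eq_zero_of_mem_groupVN {T : L2 G →L[ℂ] L2 G} (hT : T ∈ groupVN G)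
    (h : T (deltaOne G) = 0) : T = 0 := by
  refine eq_zero_of_apply_delta fun g => ?_
  rw [← rightTranslate_deltaOne, ← mul_apply_eq_comp,
    ← (commute_rightTranslate_of_mem_groupVN hT _).eq, mul_apply_eq_comp, h,
    map_zero]

/-- If only finitely many elements of `G` have a finite conjugacy class, then the central
projections of `L(G)` lie in the group algebra. -/
theorem IsCentralProjection.exists_regRep_eq {q : L2 G →L[ℂ] L2 G} (hq : IsCentralProjection q)
    (hfin : {g : G | (Set.range fun h : G => h * g * h⁻¹).Finite}.Finite) :
    ∃ b, regRep G b = q := by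
  set ξ := q (deltaOne G) with hξ
  -- q commutes with left and right translations, and conjugation fixes δ_e.
  have hconj : ∀ h x : G, ξ (h * x * h⁻¹) = ξ x := fun h x => by
    have h1 := hq.2.2 _ (regRep_mem_groupVN (MonoidAlgebra.single h⁻¹ 1))
    rw [regRep_single, one_smul] at h1
    have h2 := commute_rightTranslate_of_mem_groupVN hq.2.1 h⁻¹
    have h3 : leftRegular G h⁻¹ (rightTranslate h⁻¹ (deltaOne G)) = deltaOne G := by
      rw [rightTranslate_deltaOne, leftRegular_delta, inv_mul_cancel, delta_one]
    have h4 : leftRegular G h⁻¹ (rightTranslate h⁻¹ ξ) = ξ := by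
      conv_rhs => rw [hξ, ← h3]
      have e1 := congrArg (fun S : L2 G →L[ℂ] L2 G => S (deltaOne G)) h2.eq
      have e2 := congrArg (fun S : L2 G →L[ℂ] L2 G => S (rightTranslate h⁻¹ (deltaOne G))) h1
      simp only [mul_apply_eq_comp] at e1 e2
      rw [← e2, ← e1]
    have h5 := congrArg (fun f : L2 G => f x) h4
    rw [← h5]
    change _ = ξ (h⁻¹⁻¹ * x * h⁻¹)
    rw [inv_inv]
  -- A square-summable function constant on an infinite conjugacy class vanishes there.
  have hsupp : (Function.support ξ).Finite := by
    refine hfin.subset fun x hx => ?_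
    have hsum := (lp.memℓp ξ).summable (by norm_num)
    by_contra hinf
    have hS : (Set.range fun h : G => h * x * h⁻¹).Infinite := hinf
    have := hS.to_subtype
    have h1 := hsum.comp_injective
      (Subtype.val_injective (p := fun y => y ∈ Set.range fun h : G => h * x * h⁻¹))
    have h2 : ((fun i => ‖ξ i‖ ^ (2 : ENNReal).toReal) ∘
        (Subtype.val : (Set.range fun h : G => h * x * h⁻¹) → G)) =
        fun _ => ‖ξ x‖ ^ (2 : ENNReal).toReal := by
      ext ⟨y, h, rfl⟩
      simp [hconj]
    rw [h2, summable_const_iff] at h1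
    simp at h1
    exact hx h1
  refine ⟨MonoidAlgebra.ofCoeff (Finsupp.ofSupportFinite ξ hsupp), ?_⟩
  rw [← sub_eq_zero]
  refine eq_zero_of_mem_groupVN (sub_mem (regRep_mem_groupVN _) hq.2.1) ?_
  ext x
  rw [_root_.sub_apply, lp.coeFn_sub, Pi.sub_apply, regRep_deltaOne, ← hξ]
  exact sub_self _

/-- Under the strong Atiyah conjecture, a central granularity below the torsion multiplier forces
infinitely many elements with a finite conjugacy class. -/
theorem infinite_of_centralGranularity_lt (hA : StrongAtiyah G)
    (h : centralGranularity G < torsionMultiplier G) :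
    {g : G | (Set.range fun h : G => h * g * h⁻¹).Finite}.Infinite := by
  intro hfin
  have hne : {t : ℝ | ∃ p : L2 G →L[ℂ] L2 G, IsCentralProjection p ∧ p ≠ 0 ∧
      t = (vnTrace p).re}.Nonempty := by
    refine ⟨_, 1, ⟨IsStarProjection.one _, one_mem _, fun x _ => by simp⟩, fun h1 => ?_, rfl⟩
    have := congrArg (fun S : L2 G →L[ℂ] L2 G => ‖S (delta 1)‖) h1
    simp [norm_delta] at this
  obtain ⟨_, ⟨p, hp, hp0, rfl⟩, hlt⟩ := exists_lt_of_csInf_lt hne h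
  obtain ⟨b, hb⟩ := hp.exists_regRep_eq hfin
  have htr : (vnTrace p).re = ‖p (deltaOne G)‖ ^ 2 := by
    rw [vnTrace, inner_apply_of_isStarProjection hp.1, Complex.ofReal_re]
  have hK : (LinearMap.ker (regRep G (1 - b)).toLinearMap).starProjection (deltaOne G) =
      p (deltaOne G) := by
    rw [map_sub, map_one, hb, starProjection_ker_one_sub hp.1]
  rw [htr] at hlt
  obtain ⟨k, hk⟩ := hA.exists_int ((by positivity : (0 : ℝ) ≤ _).trans_lt hlt) (1 - b)
  rw [hK] at hk
  have h0 := eq_zero_of_int_mul_lt hk (by positivity) hlt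
  refine hp0 (eq_zero_of_mem_groupVN hp.2.1 ?_)
  simpa using h0

end FiniteCentre

/-! ### Passing between ℓ²(Λ) and ℓ²(G) -/

section Subgroup

variable {G : Type*} [Group G] (Λ : Subgroup G)

/-- Extension by zero from `ℓ²(Λ)` to `ℓ²(G)`. -/
def extendZero : L2 Λ →ₗᵢ[ℂ] L2 G where
  toFun ξ := ⟨Function.extend Subtype.val ξ 0, by
    refine memℓp_gen ?_
    have hξ := (lp.memℓp ξ).summable (by norm_num)
    have h2 : (2 : ENNReal).toReal ≠ 0 := by norm_num
    refine (Function.Injective.summable_iff (Subtype.val_injective (p := (· ∈ Λ))) ?_).mp ?_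
    · intro x hx
      rw [Function.extend_apply' _ _ _ (by simpa using hx), Pi.zero_apply, norm_zero,
        Real.zero_rpow h2]
    · convert hξ using 2 with h
      simp⟩
  map_add' ξ η := by
    ext x
    change Function.extend Subtype.val (ξ + η : Λ → ℂ) 0 x =
      Function.extend Subtype.val (ξ : Λ → ℂ) 0 x + Function.extend Subtype.val (η : Λ → ℂ) 0 x
    by_cases hx : ∃ h : Λ, (h : G) = x
    · obtain ⟨h, rfl⟩ := hx
      simp only [Subtype.val_injective.extend_apply, Pi.add_apply]
    · simp [Function.extend_apply' _ _ _ hx]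
  map_smul' c ξ := by
    ext x
    by_cases hx : ∃ h : Λ, (h : G) = x
    · obtain ⟨h, rfl⟩ := hx
      simp
    · simp [Function.extend_apply' _ _ _ hx]
  norm_map' ξ := by
    have h2 : (0 : ℝ) < (2 : ENNReal).toReal := by norm_num
    rw [lp.norm_eq_tsum_rpow h2, lp.norm_eq_tsum_rpow h2]
    congr 1
    rw [← Function.Injective.tsum_eq (Subtype.val_injective (p := (· ∈ Λ)))]
    · refine tsum_congr fun h => ?_
      simp
    · intro x hx
      by_contra hx'
      refine hx ?_
      simp [Function.extend_apply' _ _ _ (show ¬∃ h : Λ, (h : G) = x by simpa using hx')]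

variable {Λ}

theorem extendZero_apply_coe (ξ : L2 Λ) (h : Λ) : extendZero Λ ξ h = ξ h :=
  Subtype.val_injective.extend_apply _ _ _

theorem extendZero_apply_of_notMem (ξ : L2 Λ) {x : G} (hx : x ∉ Λ) : extendZero Λ ξ x = 0 :=
  Function.extend_apply' _ _ _ (by simpa using hx)

theorem extendZero_delta (h : Λ) : extendZero Λ (delta h) = delta (h : G) := by
  ext x
  by_cases hx : x ∈ Λ
  · lift x to Λ using hx
    rw [extendZero_apply_coe]
    by_cases hxh : x = h
    · rw [hxh, delta_apply_self, delta_apply_self]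
    · rw [delta_apply_ne hxh, delta_apply_ne (by simpa using hxh)]
  · rw [extendZero_apply_of_notMem _ hx, delta_apply_ne]
    rintro rfl
    exact hx h.2

variable (Λ) in
/-- Restriction of functions from `ℓ²(G)` to `ℓ²(Λ)`. -/
def restrict : L2 G →L[ℂ] L2 Λ :=
  ContinuousLinearMap.adjoint (extendZero Λ).toContinuousLinearMap

theorem restrict_apply (f : L2 G) (h : Λ) : restrict Λ f h = f h := by
  rw [← inner_delta, restrict, ContinuousLinearMap.adjoint_inner_right]
  change inner ℂ (extendZero Λ (delta h)) f = f h
  rw [extendZero_delta, inner_delta]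

theorem restrict_deltaOne : restrict Λ (deltaOne G) = deltaOne Λ := by
  ext h
  rw [restrict_apply, ← extendZero_apply_coe, ← delta_one (G := Λ), extendZero_delta]
  rfl

theorem norm_restrict_le (f : L2 G) : ‖restrict Λ f‖ ≤ ‖f‖ := by
  refine (ContinuousLinearMap.le_opNorm _ _).trans (mul_le_of_le_one_left (norm_nonneg _) ?_)
  rw [restrict, LinearIsometryEquiv.norm_map]
  exact (extendZero Λ).norm_toContinuousLinearMap_le

variable (Λ) in
/-- The orthogonal projection of `ℓ²(G)` onto the functions supported in `Λ`. -/
def cutoff : L2 G →L[ℂ] L2 G := (extendZero Λ).toContinuousLinearMap ∘L restrict Λ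

theorem cutoff_eq (f : L2 G) : cutoff Λ f = extendZero Λ (restrict Λ f) := rfl

theorem star_cutoff : star (cutoff Λ) = cutoff Λ := by
  rw [ContinuousLinearMap.star_eq_adjoint, cutoff, ContinuousLinearMap.adjoint_comp, restrict,
    ContinuousLinearMap.adjoint_adjoint]

theorem cutoff_apply_of_mem (f : L2 G) {x : G} (hx : x ∈ Λ) : cutoff Λ f x = f x := by
  lift x to Λ using hx
  rw [cutoff_eq, extendZero_apply_coe, restrict_apply]

theorem cutoff_apply_of_notMem (f : L2 G) {x : G} (hx : x ∉ Λ) : cutoff Λ f x = 0 :=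
  extendZero_apply_of_notMem _ hx

theorem commute_leftRegular_cutoff {g : G} (hg : g ∈ Λ) :
    Commute (leftRegular G g) (cutoff Λ) := by
  ext f x
  rw [mul_apply_eq_comp, mul_apply_eq_comp, leftRegular_apply]
  by_cases hx : x ∈ Λ
  · rw [cutoff_apply_of_mem _ hx, cutoff_apply_of_mem _ (mul_mem (inv_mem hg) hx),
      leftRegular_apply]
  · rw [cutoff_apply_of_notMem _ hx, cutoff_apply_of_notMem]
    rwa [Subgroup.mul_mem_cancel_left _ (inv_mem hg)]

/-- The part of `a` supported in the coset `gΛ`, translated to `Λ`. -/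
def cosetPart (Λ : Subgroup G) (g : G) (a : MonoidAlgebra ℂ G) : MonoidAlgebra ℂ Λ :=
  MonoidAlgebra.ofCoeff (a.coeff.comapDomain (fun h : Λ => g * h)
    ((mul_right_injective g).comp Subtype.val_injective).injOn)

theorem coeff_cosetPart (g : G) (a : MonoidAlgebra ℂ G) (h : Λ) :
    (cosetPart Λ g a).coeff h = a.coeff (g * h) := rfl

/-- Since ξ lives on Λ, only the coefficients of a on gΛ contribute at a point of gΛ. This reduces
annihilation by a to annihilation by elements of ℂ[Λ]. -/
theorem regRep_extendZero (a : MonoidAlgebra ℂ G) (ξ : L2 Λ) (g : G) (h : Λ) :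
    regRep G a (extendZero Λ ξ) (g * h) = regRep Λ (cosetPart Λ g a) ξ h := by
  classical
  rw [regRep_apply, regRep_apply, Finsupp.sum, Finsupp.sum]
  symm
  refine Finset.sum_of_injOn (fun k : Λ => g * k)
    ((mul_right_injective g).comp Subtype.val_injective).injOn ?_ ?_ ?_
  · intro k hk
    simpa [coeff_cosetPart] using hk
  · intro x hx hx'
    rw [extendZero_apply_of_notMem, mul_zero]
    intro hmem
    refine hx' ⟨⟨g⁻¹ * x, ?_⟩, ?_, by simp⟩
    · have : g⁻¹ * x = h * (x⁻¹ * (g * h))⁻¹ := by group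
      rw [this]
      exact mul_mem h.2 (inv_mem hmem)
    · simpa [coeff_cosetPart] using hx
  · intro k _
    have : (g * k)⁻¹ * (g * h) = ((k⁻¹ * h : Λ) : G) := by push_cast; group
    rw [coeff_cosetPart, this, extendZero_apply_coe]

end Subgroup

/-! ### A commutative C*-algebra containing the class sums -/

section CentralAlgebra

variable {G : Type*} [Group G] (Λ : Subgroup G)

/-- The `*`-subalgebra `λ(ℂ[G])` of `B(ℓ²(G))`. -/
def regRepRange (G : Type*) [Group G] : StarSubalgebra ℂ (L2 G →L[ℂ] L2 G) where
  toSubalgebra := (regRep G).range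
  star_mem' := by
    rintro _ ⟨a, rfl⟩
    exact ⟨involution a, regRep_involution a⟩

/-- The elements of the reduced group `C*`-algebra of `G` that commute with `λ(ℂ[G])` and with the
projection onto `ℓ²(Λ)`. -/
def centralAlgebra : StarSubalgebra ℂ (L2 G →L[ℂ] L2 G) :=
  (regRepRange G).topologicalClosure ⊓
    StarSubalgebra.centralizer ℂ (Set.range (regRep G) ∪ {cutoff Λ})

variable {Λ}

theorem mem_centralAlgebra_iff {T : L2 G →L[ℂ] L2 G} :
    T ∈ centralAlgebra Λ ↔ T ∈ closure (Set.range (regRep G)) ∧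
      (∀ a, Commute (regRep G a) T) ∧ Commute (cutoff Λ) T := by
  rw [centralAlgebra, StarSubalgebra.mem_inf, StarSubalgebra.mem_centralizer_iff]
  refine and_congr Iff.rfl ⟨fun h => ⟨fun a => (h _ (Or.inl ⟨a, rfl⟩)).1, (h _ (Or.inr rfl)).1⟩, ?_⟩
  rintro ⟨h1, h2⟩ _ (⟨a, rfl⟩ | rfl)
  · rw [← regRep_involution]
    exact ⟨h1 _, h1 _⟩
  · rw [star_cutoff]
    exact ⟨h2, h2⟩

theorem isClosed_centralAlgebra : IsClosed (centralAlgebra Λ : Set (L2 G →L[ℂ] L2 G)) :=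
  (StarSubalgebra.isClosed_topologicalClosure _).inter (Set.isClosed_centralizer _)

theorem commute_of_mem_centralAlgebra {S T : L2 G →L[ℂ] L2 G} (hS : S ∈ centralAlgebra Λ)
    (hT : T ∈ centralAlgebra Λ) : Commute S T := by
  have h1 := (mem_centralAlgebra_iff.mp hS).1
  have h2 := (mem_centralAlgebra_iff.mp hT).2.1
  have : closure (Set.range (regRep G)) ⊆ Set.centralizer {T} :=
    closure_minimal (by
      rintro _ ⟨a, rfl⟩ _ rfl
      exact (h2 a).symm) (Set.isClosed_centralizer _)
  exact (this h1 T rfl).symm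

/-- The sum of a finite conjugacy class, acting on `ℓ²(G)`. -/
def classSum (C : ConjClasses G) : L2 G →L[ℂ] L2 G :=
  ∑ᶠ x ∈ C.carrier, leftRegular G x

theorem classSum_mem_centralAlgebra [Λ.Normal] {C : ConjClasses G} (hfin : C.carrier.Finite)
    (hC : C.carrier ⊆ Λ) : classSum C ∈ centralAlgebra Λ := by
  rw [classSum, finsum_mem_eq_finite_toFinset_sum _ hfin, mem_centralAlgebra_iff]
  refine ⟨subset_closure ⟨∑ x ∈ hfin.toFinset, MonoidAlgebra.single x 1, ?_⟩, fun a => ?_, ?_⟩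
  · simp [regRep_single]
  · refine (commute_regRep (fun g => ?_) a).symm
    rw [Commute, SemiconjBy, Finset.sum_mul, Finset.mul_sum]
    refine Finset.sum_bij' (fun x _ => g⁻¹ * x * g) (fun x _ => g * x * g⁻¹) ?_ ?_ ?_ ?_ ?_
    · intro x hx
      simp only [Set.Finite.mem_toFinset, ConjClasses.mem_carrier_iff_mk_eq] at hx ⊢
      rw [← hx, ConjClasses.mk_eq_mk_iff_isConj, isConj_iff]
      exact ⟨g, by group⟩
    · intro x hx
      simp only [Set.Finite.mem_toFinset, ConjClasses.mem_carrier_iff_mk_eq] at hx ⊢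
      rw [← hx, ConjClasses.mk_eq_mk_iff_isConj, isConj_iff]
      exact ⟨g⁻¹, by group⟩
    · intro x _; group
    · intro x _; group
    · intro x _
      rw [← map_mul, ← map_mul]
      congr 1
      group
  · exact Commute.sum_right _ _ _ fun x hx =>
      (commute_leftRegular_cutoff (hC (hfin.mem_toFinset.mp hx))).symm

theorem classSum_deltaOne_apply {C : ConjClasses G} (hfin : C.carrier.Finite) (x : G)
    [Decidable (x ∈ C.carrier)] :
    classSum C (deltaOne G) x = if x ∈ C.carrier then 1 else 0 := by
  classical
  rw [classSum, finsum_mem_eq_finite_toFinset_sum _ hfin, _root_.sum_apply, lp.coeFn_sum,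
    Finset.sum_apply]
  simp only [← delta_one, leftRegular_delta, mul_one]
  split_ifs with hx
  · rw [Finset.sum_eq_single x (fun y _ hy => delta_apply_ne hy.symm)
      (fun h => absurd (hfin.mem_toFinset.mpr hx) h), delta_apply_self]
  · refine Finset.sum_eq_zero fun y hy => delta_apply_ne ?_
    rintro rfl
    exact hx (hfin.mem_toFinset.mp hy)

/-- Applied to δ_e, class sums become indicator functions of disjoint nonempty sets, so they are
linearly independent. -/
theorem not_finiteDimensional_centralAlgebra [Λ.Normal]
    (hinf : {C : ConjClasses G | C.carrier.Finite ∧ C.carrier ⊆ Λ}.Infinite) :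
    ¬ FiniteDimensional ℂ (centralAlgebra Λ) := by
  classical
  intro hfd
  set S := {C : ConjClasses G | C.carrier.Finite ∧ C.carrier ⊆ Λ}
  have : Infinite S := hinf.to_subtype
  let v : S → centralAlgebra Λ := fun C => ⟨classSum C.1, classSum_mem_centralAlgebra C.2.1 C.2.2⟩
  have hv : LinearIndependent ℂ v := by
    rw [linearIndependent_iff']
    intro s c hc C hCs
    obtain ⟨x, hx⟩ := ConjClasses.exists_rep C.1
    have hxC : ∀ D : S, x ∈ D.1.carrier ↔ D = C := fun D => by
      rw [ConjClasses.mem_carrier_iff_mk_eq, ← Subtype.coe_inj, ← hx]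
      exact eq_comm
    have h1 : (∑ D ∈ s, c D • classSum D.1) (deltaOne G) x = 0 := by
      have := congrArg (fun T : centralAlgebra Λ => (T : L2 G →L[ℂ] L2 G)) hc
      simp only [AddSubmonoidClass.coe_finsetSum] at this
      have h2 : ∑ D ∈ s, c D • classSum D.1 = (0 : L2 G →L[ℂ] L2 G) := this
      rw [h2]; rfl
    rw [_root_.sum_apply, lp.coeFn_sum, Finset.sum_apply,
      Finset.sum_eq_single C _ (fun h => absurd hCs h)] at h1
    · have h3 := classSum_deltaOne_apply C.2.1 x
      rw [if_pos ((hxC C).mpr rfl)] at h3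
      change c C • classSum C.1 (deltaOne G) x = 0 at h1
      rw [h3] at h1
      simpa using h1
    · intro D _ hD
      change c D • classSum D.1 (deltaOne G) x = 0
      rw [classSum_deltaOne_apply D.2.1, if_neg fun h => hD ((hxC D).mp h), smul_zero]
  have := hv.finite
  exact not_finite S

theorem exists_mem_centralAlgebra
    (hinf : ¬ FiniteDimensional ℂ (centralAlgebra Λ)) {ε : ℝ} (hε : 0 < ε) :
    ∃ f ∈ centralAlgebra Λ, f ≠ 0 ∧
      ‖deltaOne G - (LinearMap.ker f.toLinearMap).starProjection (deltaOne G)‖ ^ 2 < ε := by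
  have hc : IsClosed (centralAlgebra Λ : Set (L2 G →L[ℂ] L2 G)) := isClosed_centralAlgebra
  let inst : CommCStarAlgebra (centralAlgebra Λ) :=
    { StarSubalgebra.cstarAlgebra (h_closed := hc) (centralAlgebra Λ) with
      mul_comm := fun S T => Subtype.ext (commute_of_mem_centralAlgebra S.2 T.2) }
  obtain ⟨f, hf0, hfs, hfo⟩ := exists_orthogonal_selfAdjoint (centralAlgebra Λ) hinf
  obtain ⟨n, hn⟩ := exists_ker_close (fun n => (f n : L2 G →L[ℂ] L2 G))
    (fun n => congrArg Subtype.val (hfs n)) (fun i j hij => congrArg Subtype.val (hfo i j hij))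
    (deltaOne G) hε
  exact ⟨f n, (f n).2, fun h => hf0 n (Subtype.ext h), hn⟩

end CentralAlgebra

/-! ### Finite conjugacy classes and finite index -/

section ConjugacyClasses

variable {G : Type*} [Group G] {Λ : Subgroup G}

/-- Finite conjugacy classes of a normal subgroup of finite index generate finite conjugacy classes
of the ambient group. -/
theorem infinite_conjClasses_of_finiteIndex [Λ.Normal] [Λ.FiniteIndex]
    (h : {g : Λ | (Set.range fun h : Λ => h * g * h⁻¹).Finite}.Infinite) :
    {C : ConjClasses G | C.carrier.Finite ∧ C.carrier ⊆ Λ}.Infinite := by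
  intro hfin
  have hU : (⋃ C ∈ {C : ConjClasses G | C.carrier.Finite ∧ C.carrier ⊆ Λ}, C.carrier).Finite :=
    hfin.biUnion fun C hC => hC.1
  refine h (Set.Finite.of_finite_image (f := Subtype.val) (hU.subset ?_)
    Subtype.val_injective.injOn)
  rintro _ ⟨g, hg, rfl⟩
  refine Set.mem_biUnion (x := ConjClasses.mk (g : G)) ⟨?_, ?_⟩ ConjClasses.mem_carrier_mk
  · have hg' : (Set.range fun h : Λ => h * g * h⁻¹).Finite := hg
    have := hg'.to_subtype
    refine (Set.finite_range fun p : (G ⧸ Λ) × (Set.range fun h : Λ => h * g * h⁻¹) =>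
      p.1.out * (p.2 : Λ) * p.1.out⁻¹).subset ?_
    intro x hx
    rw [ConjClasses.mem_carrier_iff_mk_eq, ConjClasses.mk_eq_mk_iff_isConj, isConj_comm,
      isConj_iff] at hx
    obtain ⟨c, rfl⟩ := hx
    obtain ⟨k, hk⟩ := QuotientGroup.mk_out_eq_mul Λ c
    -- The chosen representative of cΛ is ck, so c g c⁻¹ is its conjugate of the Λ-conjugate k⁻¹ g
    -- k.
    refine ⟨(c, ⟨_, k⁻¹, rfl⟩), ?_⟩
    simp only [hk]
    push_cast
    group
  · intro x hx
    rw [ConjClasses.mem_carrier_iff_mk_eq, ConjClasses.mk_eq_mk_iff_isConj, isConj_comm,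
      isConj_iff] at hx
    obtain ⟨c, rfl⟩ := hx
    exact ‹Λ.Normal›.conj_mem _ g.2 c

end ConjugacyClasses

/-! ### C*-norms from projections in the commutant -/

section CutDownNorm

variable {G : Type*} [Group G]

/-- The norm `a ↦ ‖λ(a) q‖` on the group algebra, for a projection `q` commuting with `λ(ℂ[G])` and
separating it. -/
def cutDownNorm (q : L2 G →L[ℂ] L2 G) (hq : IsStarProjection q)
    (hcomm : ∀ a, Commute (regRep G a) q) (hinj : ∀ a, regRep G a * q = 0 → a = 0) :
    AlgebraNorm ℂ (MonoidAlgebra ℂ G) where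
  toFun a := ‖regRep G a * q‖
  map_zero' := by simp
  add_le' a b := by
    rw [map_add, add_mul]
    exact norm_add_le _ _
  neg' a := by rw [map_neg, neg_mul, norm_neg]
  mul_le' a b := by
    have : regRep G (a * b) * q = regRep G a * q * (regRep G b * q) := by
      rw [mul_assoc, ← mul_assoc q, ← (hcomm b).eq, mul_assoc (regRep G b),
        hq.isIdempotentElem.eq, map_mul, mul_assoc]
    rw [this]
    exact norm_mul_le _ _
  eq_zero_of_map_eq_zero' a h := hinj a (norm_eq_zero.mp h)
  smul' c a := by rw [map_smul, smul_mul_assoc, norm_smul]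

variable {q : L2 G →L[ℂ] L2 G} (hq : IsStarProjection q)
    (hcomm : ∀ a, Commute (regRep G a) q) (hinj : ∀ a, regRep G a * q = 0 → a = 0)

theorem cutDownNorm_apply (a : MonoidAlgebra ℂ G) :
    cutDownNorm q hq hcomm hinj a = ‖regRep G a * q‖ := rfl

theorem isCStarNorm_cutDownNorm : IsCStarNorm (cutDownNorm q hq hcomm hinj) := by
  intro a
  rw [cutDownNorm_apply, cutDownNorm_apply, sq, ← CStarRing.norm_star_mul_self, star_mul,
    hq.isSelfAdjoint.star_eq, map_mul, regRep_involution, ← regRep_involution,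
    ← mul_assoc (q * _), ← (hcomm _).eq, mul_assoc _ q, ← (hcomm a).eq, mul_assoc, mul_assoc,
    mul_assoc, hq.isIdempotentElem.eq]

theorem cutDownNorm_le (a : MonoidAlgebra ℂ G) :
    cutDownNorm q hq hcomm hinj a ≤ reducedNorm a :=
  (norm_mul_le _ _).trans (mul_le_of_le_one_right (norm_nonneg _) hq.norm_le)

theorem not_isReducedCStarUnique_of_mul_eq_zero {f : L2 G →L[ℂ] L2 G}
    (hf : f ∈ closure (Set.range (regRep G))) (hf0 : f ≠ 0) (hfq : f * q = 0)
    (hq : IsStarProjection q)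
    (hcomm : ∀ a, Commute (regRep G a) q) (hinj : ∀ a, regRep G a * q = 0 → a = 0) :
    ¬ IsReducedCStarUnique G := by
  rw [IsReducedCStarUnique, not_not]
  refine ⟨cutDownNorm q hq hcomm hinj, isCStarNorm_cutDownNorm hq hcomm hinj,
    cutDownNorm_le hq hcomm hinj, ?_⟩
  by_contra! h
  have hclosed : IsClosed {T : L2 G →L[ℂ] L2 G | ‖T * q‖ = ‖T‖} :=
    isClosed_eq (by fun_prop) (by fun_prop)
  have hsub : closure (Set.range (regRep G)) ⊆ {T : L2 G →L[ℂ] L2 G | ‖T * q‖ = ‖T‖} :=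
    closure_minimal (by rintro _ ⟨a, rfl⟩; exact h a) hclosed
  have h1 : ‖f * q‖ = ‖f‖ := hsub hf
  rw [hfq, norm_zero] at h1
  exact hf0 (norm_eq_zero.mp h1.symm)

end CutDownNorm

/-! ### Faithfulness on the kernel -/

section Separation

variable {G : Type*} [Group G] {Λ : Subgroup G}

/-- Under the strong Atiyah conjecture for `Λ`, the group algebra of `G` acts faithfully on the
kernel of an operator commuting with the projection onto `ℓ²(Λ)`, as soon as this kernel is close
to `δ_e`. -/
theorem StrongAtiyah.eq_zero_of_regRep_mul_eq_zero (hA : StrongAtiyah Λ) {f : L2 G →L[ℂ] L2 G}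
    (hf : Commute (cutoff Λ) f)
    (hclose : ‖deltaOne G - (LinearMap.ker f.toLinearMap).starProjection (deltaOne G)‖ ^ 2 <
      torsionMultiplier Λ)
    (a : MonoidAlgebra ℂ G)
    (ha : regRep G a * (LinearMap.ker f.toLinearMap).starProjection = 0) : a = 0 := by
  set K := LinearMap.ker f.toLinearMap
  set v := restrict Λ (K.starProjection (deltaOne G)) with hv
  have hvK : extendZero Λ v ∈ K := by
    change f (cutoff Λ (K.starProjection (deltaOne G))) = 0
    have h0 : f (K.starProjection (deltaOne G)) = 0 := Submodule.starProjection_apply_mem K _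
    rw [← mul_apply_eq_comp, ← hf.eq, mul_apply_eq_comp, h0, map_zero]
  have hav : regRep G a (extendZero Λ v) = 0 := by
    have := congrArg (fun T : L2 G →L[ℂ] L2 G => T (extendZero Λ v)) ha
    rw [mul_apply_eq_comp] at this
    have hfix : K.starProjection (extendZero Λ v) = extendZero Λ v :=
      Submodule.starProjection_eq_self_iff.mpr hvK
    rwa [hfix] at this
  have hdist : ‖deltaOne Λ - v‖ ^ 2 < torsionMultiplier Λ := by
    refine lt_of_le_of_lt ?_ hclose
    rw [hv, ← restrict_deltaOne, ← map_sub]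
    gcongr
    exact norm_restrict_le _
  -- The coefficient of a at g is the coefficient at the identity of its part on gΛ.
  ext g
  have hb : cosetPart Λ g a = 0 := by
    refine hA.eq_zero_of_close _ v ?_ hdist
    ext h
    rw [← regRep_extendZero, hav]
    rfl
  have h1 := coeff_cosetPart (Λ := Λ) g a 1
  rw [hb, OneMemClass.coe_one, mul_one] at h1
  exact h1.symm

end Separation

/-! ### Conclusion -/

theorem centralGranularity_nonneg (G : Type*) [Group G] : 0 ≤ centralGranularity G := by
  refine Real.sInf_nonneg ?_
  rintro _ ⟨p, hp, -, rfl⟩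
  rw [vnTrace, inner_apply_of_isStarProjection hp.1, Complex.ofReal_re]
  positivity

theorem not_isReducedCStarUnique {Γ : Type*} [Group Γ] (Λ : Subgroup Γ) [Λ.Normal]
    [Λ.FiniteIndex] (hAtiyah : StrongAtiyah Λ)
    (hsmall : (Λ.index : ℝ) ^ 2 * centralGranularity Λ < torsionMultiplier Λ) :
    ¬ IsReducedCStarUnique Γ := by
  have hσ := centralGranularity_nonneg Λ
  have hindex : (1 : ℝ) ≤ (Λ.index : ℝ) ^ 2 :=
    one_le_pow₀ (by exact_mod_cast Nat.one_le_iff_ne_zero.mpr Subgroup.FiniteIndex.index_ne_zero)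
  have hθ : 0 < torsionMultiplier Λ := lt_of_le_of_lt (by positivity) hsmall
  have hlt : centralGranularity Λ < torsionMultiplier Λ :=
    (le_mul_of_one_le_left hσ hindex).trans_lt hsmall
  obtain ⟨f, hf, hf0, hclose⟩ := exists_mem_centralAlgebra
    (not_finiteDimensional_centralAlgebra (infinite_conjClasses_of_finiteIndex
      (infinite_of_centralGranularity_lt hAtiyah hlt))) hθ
  obtain ⟨hfcl, hfcomm, hfcut⟩ := mem_centralAlgebra_iff.mp hf
  refine not_isReducedCStarUnique_of_mul_eq_zero
    (q := (LinearMap.ker f.toLinearMap).starProjection) hfcl hf0 ?_ isStarProjection_starProjection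
    (fun a => commute_starProjection_ker (hfcomm a) ?_)
    (hAtiyah.eq_zero_of_regRep_mul_eq_zero hfcut hclose)
  · ext1 v
    exact Submodule.starProjection_apply_mem (LinearMap.ker f.toLinearMap) v
  · rw [← regRep_involution]
    exact hfcomm _

end GroupAlgebraNorms

end

theorem theorem3 {Γ : Type*} [Group Γ] [Countable Γ] (Λ : Subgroup Γ) [Λ.Normal] [Λ.FiniteIndex]
    (hAtiyah : GroupAlgebraNorms.StrongAtiyah Λ)
    (hsmall : (Λ.index : ℝ) ^ 2 * GroupAlgebraNorms.centralGranularity Λ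
      < GroupAlgebraNorms.torsionMultiplier Λ) :
    ¬ GroupAlgebraNorms.IsReducedCStarUnique Γ :=
  GroupAlgebraNorms.not_isReducedCStarUnique Λ hAtiyah hsmall
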